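/- Let $(\mathcal S,\mathcal A,\mathbb P,r,\gamma)$ be a discounted Markov decision process with finite state space $\mathcal S$, finite non-empty action space $\mathcal A$, discount factor $\gamma\in(0,1)$ and rewards $r(s,a)\in[0,\bar r]$. Let $\rho$ be a probability distribution on $\mathcal S$, $\lambda\ge 0$, and for $\theta\in\mathbb R^{|\mathcal S||\mathcal A|}$ let $\pi_\theta(a|s)=\exp(\theta_{s,a})/\sum_{a'\in\mathcal A}\exp(\theta_{s,a'})$ be the softmax policy. Let $\tau=(s_0,a_0,s_1,a_1,\dots)$ be the random trajectory with $s_0\sim\rho$, $a_t\sim\pi_\theta(\cdot|s_t)$, $s_{t+1}\sim\mathbb P(\cdot|s_t,a_t)$, and let $\mathbb E$ be the expectation over $\tau$. Define the entropy-regularized value $$V^\theta_\lambda(\rho)=\mathbb E\Big[\sum_{t=0}^\infty\gamma^t r(s_t,a_t)\Big]+\lambda\,\mathbb E\Big[\sum_{t=0}^\infty-\gamma^t\log\pi_\theta(a_t|s_t)\Big]$$ and, for a horizon $H\in\mathbb N$, the truncated GPOMDP estimator $$\hat\nabla V^{\theta,H}_\lambda(\rho)=\sum_{h=0}^{H-1}\Big(\sum_{j=0}^{h}\nabla_\theta\log\pi_\theta(a_j|s_j)\Big)\gamma^h\big(r(s_h,a_h)-\lambda\log\pi_\theta(a_h|s_h)\big).$$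 Then, for every $\theta$, the function $\theta\mapsto V^\theta_\lambda(\rho)$ is differentiable at $\theta$, and for every $H$ the estimator is integrable and $$\Big\|\mathbb E\big[\hat\nabla V^{\theta,H}_\lambda(\rho)\big]-\nabla_\theta V^\theta_\lambda(\rho)\Big\|_2\le\frac{2(\bar r+\lambda\log|\mathcal A|)\,\gamma^H}{1-\gamma}\Big(H+\frac1{1-\gamma}\Big).$$ In particular the bias decays geometrically in $H$: for every $q\in(\gamma,1)$ it is $O(q^H)$ as $H\to\infty$. -/

import Mathlib

open MeasureTheory ProbabilityTheory

noncomputable section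

/-- A discounted Markov decision process with state space `S` and action space `A`:
transition probabilities `P s a s' = ℙ(s' | s, a)`, reward `r`, discount factor `γ`. -/
structure MDP (S A : Type*) where
  P : S → A → PMF S
  r : S → A → ℝ
  γ : ℝ

/-- The parameter space `ℝ^{|S||A|}` with its Euclidean norm. -/
abbrev Param (S A : Type*) [Fintype S] [Fintype A] := EuclideanSpace ℝ (S × A)

section Softmax

variable {S A : Type*} [Fintype S] [Fintype A]

/-- `π_θ(a | s) = exp θ_{s,a} / ∑_{a'} exp θ_{s,a'}`. -/
def softmaxProb (θ : Param S A) (s : S) (a : A) : ℝ :=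
  Real.exp (θ (s, a)) / ∑ a' : A, Real.exp (θ (s, a'))

theorem sum_ofReal_softmaxProb [Nonempty A] (θ : Param S A) (s : S) :
    ∑ a : A, ENNReal.ofReal (softmaxProb θ s a) = 1 := by
  have hpos : 0 < ∑ a' : A, Real.exp (θ (s, a')) :=
    Finset.sum_pos (fun _ _ => Real.exp_pos _) Finset.univ_nonempty
  simp only [softmaxProb]
  rw [← ENNReal.ofReal_sum_of_nonneg (fun a _ => div_nonneg (Real.exp_pos _).le hpos.le), ← Finset.sum_div, div_self hpos.ne', ENNReal.ofReal_one]

/-- The softmax policy `π_θ`, as a probability distribution on actions for each state. -/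
def softmaxPolicy [Nonempty A] (θ : Param S A) (s : S) : PMF A :=
  PMF.ofFintype (fun a => ENNReal.ofReal (softmaxProb θ s a)) (sum_ofReal_softmaxProb θ s)

/-- The score function `∇_θ log π_θ(a | s)`. -/
def score (θ : Param S A) (s : S) (a : A) : Param S A :=
  gradient (fun θ' : Param S A => Real.log (softmaxProb θ' s a)) θ

end Softmax

namespace MDP

variable {S A : Type*} [Fintype S] [Fintype A]
  [MeasurableSpace S] [DiscreteMeasurableSpace S] [MeasurableSpace A] [DiscreteMeasurableSpace A]

/-- The joint law of `(s, a)` when `s ∼ ν` and `a ∼ π(· | s)`. -/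
def stateActionLaw (ν : PMF S) (π : S → PMF A) : PMF (S × A) :=
  ν.bind fun s => (π s).map fun a => (s, a)

/-- One step of the chain: from `(s, a)` draw `s' ∼ ℙ(· | s, a)` and then `a' ∼ π(· | s')`. -/
def stepKernel (M : MDP S A) (π : S → PMF A) : Kernel (S × A) (S × A) :=
  Kernel.ofFunOfCountable fun z => (stateActionLaw (M.P z.1 z.2) π).toMeasure

instance (M : MDP S A) (π : S → PMF A) : IsMarkovKernel (M.stepKernel π) :=
  ⟨fun z => PMF.toMeasure.isProbabilityMeasure (stateActionLaw (M.P z.1 z.2) π)⟩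

/-- The step kernel as a kernel on histories `(s₀, a₀), …, (sₙ, aₙ)`; it only depends on the last
state-action pair. -/
def historyKernel (M : MDP S A) (π : S → PMF A) (n : ℕ) :
    Kernel ((i : Finset.Iic n) → (fun _ : ℕ => S × A) i) ((fun _ : ℕ => S × A) (n + 1)) :=
  (M.stepKernel π).comap (fun h => h ⟨n, Finset.mem_Iic.2 le_rfl⟩) (measurable_pi_apply _)

instance (M : MDP S A) (π : S → PMF A) (n : ℕ) : IsMarkovKernel (M.historyKernel π n) := by
  unfold historyKernel; infer_instance

/-- The law of the infinite trajectory `τ = (s₀, a₀), (s₁, a₁), …` under the policy `π`, with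
`(s₀, a₀)` of law `μ₀`. -/
def trajectoryLaw (M : MDP S A) (π : S → PMF A) (μ₀ : PMF (S × A)) : Measure (ℕ → S × A) :=
  Kernel.trajMeasure (X := fun _ : ℕ => S × A) μ₀.toMeasure (M.historyKernel π)

/-- The trajectory law with `s₀ ∼ ρ` and `a₀ ∼ π(· | s₀)`. -/
def trajectoryLawFrom (M : MDP S A) (π : S → PMF A) (ρ : PMF S) : Measure (ℕ → S × A) :=
  M.trajectoryLaw π (stateActionLaw ρ π)

/-- `Q^π(s, a) = 𝔼[∑_h γ^h r(s_h, a_h) | s₀ = s, a₀ = a]`. -/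
def Q (M : MDP S A) (π : S → PMF A) (s : S) (a : A) : ℝ :=
  ∫ τ, ∑' h : ℕ, M.γ ^ h * M.r (τ h).1 (τ h).2 ∂(M.trajectoryLaw π (PMF.pure (s, a)))

/-- `V^π(s) = 𝔼_{a ∼ π(· | s)}[Q^π(s, a)]`. -/
def V (M : MDP S A) (π : S → PMF A) (s : S) : ℝ :=
  ∑ a : A, (π s a).toReal * M.Q π s a

/-- `V^π(ρ) = 𝔼_{s₀ ∼ ρ}[V^π(s₀)]`. -/
def value (M : MDP S A) (π : S → PMF A) (ρ : PMF S) : ℝ :=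
  ∑ s : S, (ρ s).toReal * M.V π s

/-- The discounted entropy `ℍ(ρ, π) = 𝔼[∑_t -γ^t log π(a_t | s_t)]`. -/
def discountedEntropy (M : MDP S A) (π : S → PMF A) (ρ : PMF S) : ℝ :=
  ∫ τ, ∑' t : ℕ, -(M.γ ^ t * Real.log (π (τ t).1 (τ t).2).toReal) ∂(M.trajectoryLawFrom π ρ)

/-- The entropy-regularized value `V_λ^π(ρ) = V^π(ρ) + λ ℍ(ρ, π)`. -/
def regValue (M : MDP S A) (lam : ℝ) (π : S → PMF A) (ρ : PMF S) : ℝ :=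
  M.value π ρ + lam * M.discountedEntropy π ρ

/-- `V_λ^θ(ρ)`, the regularized value of the softmax policy `π_θ`, as a function of `θ`. -/
def regObjective [Nonempty A] (M : MDP S A) (lam : ℝ) (ρ : PMF S) (θ : Param S A) : ℝ :=
  M.regValue lam (softmaxPolicy θ) ρ

/-- The truncated GPOMDP estimator with horizon `H` along the trajectory `τ`:
`∑_{h<H} (∑_{j≤h} ∇ log π_θ(a_j|s_j)) γ^h (r(s_h,a_h) - λ log π_θ(a_h|s_h))`. -/
def truncatedPG (M : MDP S A) (lam : ℝ) (θ : Param S A) (H : ℕ) (τ : ℕ → S × A) : Param S A :=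
  ∑ h ∈ Finset.range H,
    (M.γ ^ h * (M.r (τ h).1 (τ h).2 - lam * Real.log (softmaxProb θ (τ h).1 (τ h).2))) •
      ∑ j ∈ Finset.range (h + 1), score θ (τ j).1 (τ j).2

/-- The bias `𝔼[∇̂V_λ^{θ,H}(ρ)] - ∇V_λ^θ(ρ)` of the truncated estimator, the trajectory being
sampled with `s₀ ∼ ρ` under `π_θ`. -/
def truncationBias [Nonempty A] (M : MDP S A) (lam : ℝ) (ρ : PMF S) (θ : Param S A) (H : ℕ) :
    Param S A :=
  (∫ τ, M.truncatedPG lam θ H τ ∂(M.trajectoryLawFrom (softmaxPolicy θ) ρ)) -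
    gradient (M.regObjective lam ρ) θ

end MDP

end

/-! The objective is the series of `γ ^ n` times the expected regularized reward at time `n`
(`hasSum_regObjective`). Each expectation is a finite sum over pairs `z` of reward at `z` times the
probability of being at `z`, so only these probabilities need differentiating, not a measure on
infinite trajectories. Their gradients are score-weighted expectations
(`hasGradientAt_integral_indicator`, by induction on time). The product rule also differentiates `-λ
log π_θ` inside the reward, but that term vanishes because the score has mean zero at every state.
Hence the gradient of the `n`-th term is exactly the mean of the `n`-th summand of the estimator.

Differentiating termwise needs a bound uniform in `θ`. The regularized reward has none pointwise,
but it is nonnegative and its policy mean is at most `rbar + λ log |A|`, by the entropy bound; each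
score has norm at most 2. So the `n`-th undiscounted gradient is at most `2 (n + 1) (rbar + λ log
|A|)` (`norm_stepGradient_le`). The bias is then minus the tail of the gradient series from `H` on,
and the dominating tail sums in closed form to the stated bound. -/

noncomputable section

/-! ### Trajectory laws and the Markov property -/

namespace MDP

variable {S A : Type*} [Fintype S] [Fintype A] {E : Type*} [NormedAddCommGroup E]

theorem stateActionLaw_apply (ν : PMF S) (π : S → PMF A) (z : S × A) :
    stateActionLaw ν π z = ν z.1 * π z.1 z.2 := by
  classical
  obtain ⟨s, a⟩ := z
  have hmap (s' : S) : ((π s').map fun a => (s', a)) (s, a) = if s' = s then π s a else 0 := by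
    rw [PMF.map_apply]
    by_cases h : s' = s
    · subst h
      simp
    · simp [h, Ne.symm h]
  simp [stateActionLaw, PMF.bind_apply, hmap, tsum_fintype]

theorem sum_stateActionLaw_smul [NormedSpace ℝ E] (ν : PMF S) (π : S → PMF A) (g : S × A → E) :
    ∑ z, (stateActionLaw ν π z).toReal • g z =
      ∑ s, (ν s).toReal • ∑ a, (π s a).toReal • g (s, a) := by
  simp_rw [Fintype.sum_prod_type, stateActionLaw_apply, ENNReal.toReal_mul, mul_smul,
    Finset.smul_sum]

variable [MeasurableSpace S] [DiscreteMeasurableSpace S]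
  [MeasurableSpace A] [DiscreteMeasurableSpace A]

instance (M : MDP S A) (π : S → PMF A) (μ₀ : PMF (S × A)) :
    IsProbabilityMeasure (M.trajectoryLaw π μ₀) := by
  have : IsProbabilityMeasure μ₀.toMeasure := inferInstance
  unfold trajectoryLaw
  infer_instance

instance (M : MDP S A) (π : S → PMF A) (ρ : PMF S) :
    IsProbabilityMeasure (M.trajectoryLawFrom π ρ) := by
  unfold trajectoryLawFrom
  infer_instance

/-- A function of finitely many coordinates of the trajectory is integrable. -/
theorem integrable_comp_frestrictLe (μ : Measure (ℕ → S × A)) [IsFiniteMeasure μ] (n : ℕ)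
    (G : ((i : Finset.Iic n) → S × A) → E) :
    Integrable (fun τ : ℕ → S × A => G (Preorder.frestrictLe (π := fun _ => S × A) n τ)) μ := by
  have hm : Measurable (Preorder.frestrictLe (π := fun _ : ℕ => S × A) n) := by fun_prop
  exact (Integrable.of_finite (μ := μ.map _) (f := G)).comp_measurable hm

theorem integrable_eval (μ : Measure (ℕ → S × A)) [IsFiniteMeasure μ] (n : ℕ) (g : S × A → E) :
    Integrable (fun τ : ℕ → S × A => g (τ n)) μ :=
  integrable_comp_frestrictLe μ n fun x => g (x ⟨n, Finset.mem_Iic.2 le_rfl⟩)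

variable [NormedSpace ℝ E] [CompleteSpace E]

/-- The Markov property: conditionally on the history, the next state-action pair is drawn from
the transition kernel. -/
theorem integral_history_next (M : MDP S A) (π : S → PMF A) (μ₀ : PMF (S × A)) (n : ℕ)
    (G : ((i : Finset.Iic n) → S × A) → S × A → E) :
    ∫ τ, G (Preorder.frestrictLe (π := fun _ => S × A) n τ) (τ (n + 1)) ∂(M.trajectoryLaw π μ₀) =
      ∫ τ, ∑ z, (stateActionLaw (M.P (τ n).1 (τ n).2) π z).toReal •
        G (Preorder.frestrictLe (π := fun _ => S × A) n τ) z ∂(M.trajectoryLaw π μ₀) := by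
  have hm : Measurable (Preorder.frestrictLe (π := fun _ : ℕ => S × A) n) := by fun_prop
  have key := Kernel.map_frestrictLe_trajMeasure_compProd_eq_map_trajMeasure
    (X := fun _ : ℕ => S × A) (μ₀ := μ₀.toMeasure) (κ := M.historyKernel π) (a := n)
  have h1 := congrArg (fun ν => ∫ p, G p.1 p.2 ∂ν) key
  rw [Measure.integral_compProd .of_finite,
    integral_map (by fun_prop) AEStronglyMeasurable.of_discrete,
    integral_map (by fun_prop) AEStronglyMeasurable.of_discrete] at h1
  unfold trajectoryLaw
  rw [← h1]
  refine integral_congr_ae (.of_forall fun τ => ?_)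
  exact PMF.integral_eq_sum _ _

theorem integral_eval_succ (M : MDP S A) (π : S → PMF A) (μ₀ : PMF (S × A)) (n : ℕ)
    (g : S × A → E) :
    ∫ τ, g (τ (n + 1)) ∂(M.trajectoryLaw π μ₀) =
      ∫ τ, ∑ s, (M.P (τ n).1 (τ n).2 s).toReal • ∑ a, (π s a).toReal • g (s, a)
        ∂(M.trajectoryLaw π μ₀) := by
  rw [integral_history_next M π μ₀ n fun _ => g]
  simp_rw [sum_stateActionLaw_smul]

theorem integral_eval_zero (M : MDP S A) (π : S → PMF A) (μ₀ : PMF (S × A)) (g : S × A → E) :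
    ∫ τ, g (τ 0) ∂(M.trajectoryLaw π μ₀) = ∑ z, (μ₀ z).toReal • g z := by
  have hm : Measurable (Preorder.frestrictLe (π := fun _ : ℕ => S × A) 0) := by fun_prop
  -- Restricting the trajectory kernel to time 0 gives the identity kernel, so only the initial law
  -- remains.
  have hmap : (M.trajectoryLaw π μ₀).map (Preorder.frestrictLe (π := fun _ : ℕ => S × A) 0) =
      μ₀.toMeasure.map (MeasurableEquiv.piUnique fun _ : Finset.Iic 0 => S × A).symm := by
    unfold trajectoryLaw Kernel.trajMeasure
    rw [Measure.map_comp _ _ hm, Kernel.traj_map_frestrictLe, Kernel.partialTraj_self]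
    exact Measure.id_comp
  have h0 : (0 : ℕ) ∈ Finset.Iic 0 := Finset.mem_Iic.2 le_rfl
  calc ∫ τ, g (τ 0) ∂(M.trajectoryLaw π μ₀)
      = ∫ x, g (x ⟨0, h0⟩) ∂(M.trajectoryLaw π μ₀).map
          (Preorder.frestrictLe (π := fun _ : ℕ => S × A) 0) := by
        rw [integral_map hm.aemeasurable AEStronglyMeasurable.of_discrete]
        rfl
    _ = ∫ z, g z ∂μ₀.toMeasure := by
        rw [hmap, integral_map (MeasurableEquiv.measurable _).aemeasurable
          AEStronglyMeasurable.of_discrete]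
        rfl
    _ = _ := PMF.integral_eq_sum _ _

/-- The law at time `n` is the mixture over `μ₀` of the laws started at fixed pairs. -/
theorem integral_eval_eq_sum_pure (M : MDP S A) (π : S → PMF A) (μ₀ : PMF (S × A)) (n : ℕ)
    (g : S × A → E) :
    ∫ τ, g (τ n) ∂(M.trajectoryLaw π μ₀) =
      ∑ z, (μ₀ z).toReal • ∫ τ, g (τ n) ∂(M.trajectoryLaw π (PMF.pure z)) := by
  classical
  induction n generalizing g with
  | zero =>
    simp_rw [integral_eval_zero, PMF.pure_apply]
    simp [apply_ite ENNReal.toReal, ite_smul]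
  | succ n ih =>
    simp_rw [integral_eval_succ]
    -- The hypothesis is applied to the one-step average of `g`, which is why the induction
    -- generalizes `g`.
    exact ih fun z => ∑ s, (M.P z.1 z.2 s).toReal • ∑ a, (π s a).toReal • g (s, a)

end MDP

/-! ### Calculus rules for gradients of real functions -/

section GradientRules

variable {F : Type*} [NormedAddCommGroup F] [InnerProductSpace ℝ F] [CompleteSpace F]

theorem HasGradientAt.fun_mul_real {f g : F → ℝ} {f' g' x : F} (hf : HasGradientAt f f' x)
    (hg : HasGradientAt g g' x) :
    HasGradientAt (fun y => f y * g y) (f x • g' + g x • f') x := by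
  rw [hasGradientAt_iff_hasFDerivAt] at *
  simpa using hf.fun_mul hg

theorem HasGradientAt.fun_const_mul_real {f : F → ℝ} {f' x : F} (hf : HasGradientAt f f' x)
    (c : ℝ) : HasGradientAt (fun y => c * f y) (c • f') x := by
  rw [hasGradientAt_iff_hasFDerivAt] at *
  simpa using hf.const_mul c

theorem HasGradientAt.fun_sum_real {ι : Type*} {t : Finset ι} {f : ι → F → ℝ} {f' : ι → F} {x : F}
    (hf : ∀ i ∈ t, HasGradientAt (f i) (f' i) x) :
    HasGradientAt (fun y => ∑ i ∈ t, f i y) (∑ i ∈ t, f' i) x := by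
  simp_rw [hasGradientAt_iff_hasFDerivAt] at *
  simpa using HasFDerivAt.fun_sum hf

theorem EuclideanSpace.hasGradientAt_apply {ι : Type*} [Fintype ι] [DecidableEq ι] (i : ι)
    (x : EuclideanSpace ℝ ι) :
    HasGradientAt (fun y : EuclideanSpace ℝ ι => y i) (EuclideanSpace.single i 1) x := by
  rw [hasGradientAt_iff_hasFDerivAt]
  convert! (EuclideanSpace.proj i : EuclideanSpace ℝ ι →L[ℝ] ℝ).hasFDerivAt (x := x)
  ext v
  simp [EuclideanSpace.inner_single_left]

end GradientRules

/-! ### Softmax policy: entropy bound and score function -/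

section Softmax

variable {S A : Type*} [Fintype S] [Fintype A] [Nonempty A]

theorem sum_exp_pos (θ : Param S A) (s : S) : 0 < ∑ a : A, Real.exp (θ (s, a)) :=
  Finset.sum_pos (fun _ _ => Real.exp_pos _) Finset.univ_nonempty

theorem softmaxProb_pos (θ : Param S A) (s : S) (a : A) : 0 < softmaxProb θ s a :=
  div_pos (Real.exp_pos _) (sum_exp_pos θ s)

theorem sum_softmaxProb (θ : Param S A) (s : S) : ∑ a, softmaxProb θ s a = 1 := by
  simp only [softmaxProb]
  rw [← Finset.sum_div, div_self (sum_exp_pos θ s).ne']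

theorem softmaxProb_le_one (θ : Param S A) (s : S) (a : A) : softmaxProb θ s a ≤ 1 := by
  rw [← sum_softmaxProb θ s]
  exact Finset.single_le_sum (fun b _ => (softmaxProb_pos θ s b).le) (Finset.mem_univ a)

@[simp]
theorem toReal_softmaxPolicy (θ : Param S A) (s : S) (a : A) :
    (softmaxPolicy θ s a).toReal = softmaxProb θ s a := by
  simp [softmaxPolicy, (softmaxProb_pos θ s a).le]

/-- The entropy of the softmax policy at each state is at most `log |A|`. -/
theorem sum_softmaxProb_mul_neg_log_le (θ : Param S A) (s : S) :
    ∑ a, softmaxProb θ s a * -Real.log (softmaxProb θ s a) ≤ Real.log (Fintype.card A) := by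
  have hn : (0 : ℝ) < Fintype.card A := by exact_mod_cast Fintype.card_pos
  -- This is `log x ≤ x - 1` at `x = 1 / (|A| p)`, multiplied by `p`; the corrections `1 / |A| - p`
  -- sum to zero over the actions.
  have hterm (a : A) : softmaxProb θ s a * -Real.log (softmaxProb θ s a) ≤
      softmaxProb θ s a * Real.log (Fintype.card A) +
        ((Fintype.card A : ℝ)⁻¹ - softmaxProb θ s a) := by
    have hp := softmaxProb_pos θ s a
    have h := Real.log_le_sub_one_of_pos (inv_pos.2 (mul_pos hn hp))
    rw [Real.log_inv, Real.log_mul hn.ne' hp.ne'] at h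
    have h2 := mul_le_mul_of_nonneg_left h hp.le
    have h3 : softmaxProb θ s a * (((Fintype.card A : ℝ) * softmaxProb θ s a)⁻¹ - 1) =
        (Fintype.card A : ℝ)⁻¹ - softmaxProb θ s a := by
      field_simp
    rw [h3] at h2
    linarith
  refine (Finset.sum_le_sum fun a _ => hterm a).trans_eq ?_
  rw [Finset.sum_add_distrib, ← Finset.sum_mul, Finset.sum_sub_distrib, sum_softmaxProb]
  simp [hn.ne']

open Classical in
theorem hasGradientAt_log_softmaxProb_explicit (θ : Param S A) (s : S) (a : A) :
    HasGradientAt (fun θ' : Param S A => Real.log (softmaxProb θ' s a))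
      (EuclideanSpace.single (s, a) (1 : ℝ) -
        ∑ b, softmaxProb θ s b • EuclideanSpace.single (s, b) (1 : ℝ)) θ := by
  have heq : (fun θ' : Param S A => Real.log (softmaxProb θ' s a)) =
      fun θ' => θ' (s, a) - Real.log (∑ b, Real.exp (θ' (s, b))) := by
    funext θ'
    rw [softmaxProb, Real.log_div (Real.exp_pos _).ne' (sum_exp_pos θ' s).ne', Real.log_exp]
  rw [heq, hasGradientAt_iff_hasFDerivAt]
  have h1 (b : A) := (EuclideanSpace.hasGradientAt_apply (s, b) θ).hasFDerivAt
  have h2 := (HasFDerivAt.fun_sum (u := Finset.univ) fun b _ => (h1 b).exp).log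
    (sum_exp_pos θ s).ne'
  convert! (h1 a).sub h2 using 1
  simp only [map_sub, map_sum, map_smul, Finset.smul_sum, smul_smul, softmaxProb,
    div_eq_inv_mul]

open Classical in
theorem score_eq (θ : Param S A) (s : S) (a : A) :
    score θ s a = EuclideanSpace.single (s, a) (1 : ℝ) -
        ∑ b, softmaxProb θ s b • EuclideanSpace.single (s, b) (1 : ℝ) :=
  (hasGradientAt_log_softmaxProb_explicit θ s a).gradient

theorem hasGradientAt_log_softmaxProb (θ : Param S A) (s : S) (a : A) :
    HasGradientAt (fun θ' : Param S A => Real.log (softmaxProb θ' s a)) (score θ s a) θ :=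
  (hasGradientAt_log_softmaxProb_explicit θ s a).differentiableAt.hasGradientAt

/-- The log-derivative identity `∇ π = π ∇ log π`. -/
theorem hasGradientAt_softmaxProb (θ : Param S A) (s : S) (a : A) :
    HasGradientAt (fun θ' : Param S A => softmaxProb θ' s a)
      (softmaxProb θ s a • score θ s a) θ := by
  have h := (hasGradientAt_log_softmaxProb θ s a).hasFDerivAt.exp
  simp_rw [Real.exp_log (softmaxProb_pos _ s a)] at h
  rw [hasGradientAt_iff_hasFDerivAt]
  simpa using h

/-- The score is a basis vector minus a convex combination of basis vectors. This is the source of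
the factor 2 in the final bound. -/
theorem norm_score_le (θ : Param S A) (s : S) (a : A) : ‖score θ s a‖ ≤ 2 := by
  classical
  rw [score_eq]
  have h : ‖∑ b, softmaxProb θ s b • EuclideanSpace.single (s, b) (1 : ℝ)‖ ≤ 1 := by
    refine (norm_sum_le _ _).trans ?_
    simp [norm_smul, abs_of_pos (softmaxProb_pos _ _ _), sum_softmaxProb]
  refine (norm_sub_le _ _).trans ?_
  simp only [PiLp.norm_single, norm_one]
  linarith

theorem sum_softmaxProb_smul_score (θ : Param S A) (s : S) :
    ∑ a, softmaxProb θ s a • score θ s a = 0 := by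
  classical
  simp only [score_eq, smul_sub, Finset.sum_sub_distrib]
  rw [← Finset.sum_smul, sum_softmaxProb, one_smul, sub_self]

end Softmax

/-! ### Localized expectations and the likelihood-ratio formula -/

namespace MDP

variable {S A : Type*} [Fintype S] [Fintype A]
  [MeasurableSpace S] [DiscreteMeasurableSpace S] [MeasurableSpace A] [DiscreteMeasurableSpace A]

/-- At every time the action is drawn from the policy at the current state, so a bound on the policy
mean at each state survives averaging over states. A pointwise bound on `g` is not needed. -/
theorem integral_eval_le_of_policy_mean_le (M : MDP S A) (π : S → PMF A) (ρ : PMF S) (n : ℕ)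
    {g : S × A → ℝ} {c : ℝ} (hg : ∀ s, ∑ a, (π s a).toReal * g (s, a) ≤ c) :
    ∫ τ, g (τ n) ∂(M.trajectoryLawFrom π ρ) ≤ c := by
  have hν (ν : PMF S) : ∑ s, (ν s).toReal * ∑ a, (π s a).toReal * g (s, a) ≤ c := by
    have hsum : ∑ s, (ν s).toReal = 1 := by
      have h := ν.tsum_coe
      rw [tsum_fintype] at h
      rw [← ENNReal.toReal_sum fun s _ => ν.apply_ne_top s, h, ENNReal.toReal_one]
    calc ∑ s, (ν s).toReal * ∑ a, (π s a).toReal * g (s, a)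
        ≤ ∑ s, (ν s).toReal * c := Finset.sum_le_sum fun s _ =>
          mul_le_mul_of_nonneg_left (hg s) ENNReal.toReal_nonneg
      _ = c := by rw [← Finset.sum_mul, hsum, one_mul]
  unfold trajectoryLawFrom
  cases n with
  | zero =>
    rw [integral_eval_zero, sum_stateActionLaw_smul]
    exact hν ρ
  | succ n =>
    rw [integral_eval_succ]
    refine (integral_mono (integrable_eval _ n fun z => ∑ s, (M.P z.1 z.2 s).toReal •
      ∑ a, (π s a).toReal • g (s, a)) (integrable_const c) fun τ => hν _).trans_eq ?_
    simp

theorem integral_eval_eq_zero_of_policy_mean_eq_zero {E : Type*} [NormedAddCommGroup E]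
    [NormedSpace ℝ E] [CompleteSpace E] (M : MDP S A) (π : S → PMF A) (ρ : PMF S) (n : ℕ)
    {g : S × A → E} (hg : ∀ s, ∑ a, (π s a).toReal • g (s, a) = 0) :
    ∫ τ, g (τ n) ∂(M.trajectoryLawFrom π ρ) = 0 := by
  unfold trajectoryLawFrom
  cases n with
  | zero => simp [integral_eval_zero, sum_stateActionLaw_smul, hg]
  | succ n => simp [integral_eval_succ, hg]

theorem indicator_singleton_sum_smul {α E : Type*} [Fintype α] [AddCommGroup E] [Module ℝ E]
    (f : α → E) (x : α) : ∑ z, Set.indicator {z} (1 : α → ℝ) x • f z = f x := by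
  classical
  simp [Set.indicator_apply, ite_smul]

/-- Splitting an expectation according to the value of the trajectory at time `n`. -/
theorem sum_integral_indicator_smul {E : Type*} [NormedAddCommGroup E] [NormedSpace ℝ E]
    (μ : Measure (ℕ → S × A)) [IsFiniteMeasure μ] (n : ℕ) (f : S × A → ℝ)
    (G : ((i : Finset.Iic n) → S × A) → E) :
    ∑ z, f z • ∫ τ, Set.indicator {z} (1 : S × A → ℝ) (τ n) •
        G (Preorder.frestrictLe (π := fun _ => S × A) n τ) ∂μ =
      ∫ τ, f (τ n) • G (Preorder.frestrictLe (π := fun _ => S × A) n τ) ∂μ := by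
  simp_rw [← integral_smul]
  rw [← integral_finsetSum]
  · refine integral_congr_ae (.of_forall fun τ => ?_)
    simp only [smul_comm (f _)]
    rw [indicator_singleton_sum_smul fun z =>
      f z • G (Preorder.frestrictLe (π := fun _ => S × A) n τ)]
  · intro z _
    exact integrable_comp_frestrictLe μ n fun x => f z •
      Set.indicator {z} (1 : S × A → ℝ) (x ⟨n, Finset.mem_Iic.2 le_rfl⟩) • G x

/-- One step of the recursion for expectations localized at the current state-action pair. -/
theorem integral_indicator_succ_smul {E : Type*} [NormedAddCommGroup E] [NormedSpace ℝ E]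
    [CompleteSpace E] (M : MDP S A) (π : S → PMF A) (ρ : PMF S) (n : ℕ) (z' : S × A)
    (G : ((i : Finset.Iic n) → S × A) → E) :
    ∫ τ, Set.indicator {z'} (1 : S × A → ℝ) (τ (n + 1)) •
        G (Preorder.frestrictLe (π := fun _ => S × A) n τ) ∂(M.trajectoryLawFrom π ρ) =
      ∑ z, ((M.P z.1 z.2 z'.1).toReal * (π z'.1 z'.2).toReal) •
        ∫ τ, Set.indicator {z} (1 : S × A → ℝ) (τ n) •
          G (Preorder.frestrictLe (π := fun _ => S × A) n τ) ∂(M.trajectoryLawFrom π ρ) := by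
  classical
  rw [sum_integral_indicator_smul (M.trajectoryLawFrom π ρ) n
    (fun z => (M.P z.1 z.2 z'.1).toReal * (π z'.1 z'.2).toReal) G]
  unfold trajectoryLawFrom
  rw [integral_history_next M π _ n fun x z => Set.indicator {z'} (1 : S × A → ℝ) z • G x]
  refine integral_congr_ae (.of_forall fun τ => ?_)
  simp [Set.indicator_apply, ite_smul, stateActionLaw_apply]

/-- The accumulated score up to time `n` is a function of the history up to time `n`. -/
theorem exists_sum_score_eq_comp_frestrictLe {S A : Type*} [Fintype S] [Fintype A]
    (θ : Param S A) (n : ℕ) :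
    ∃ G : ((i : Finset.Iic n) → S × A) → Param S A, ∀ τ : ℕ → S × A,
      ∑ j ∈ Finset.range (n + 1), score θ (τ j).1 (τ j).2 =
        G (Preorder.frestrictLe (π := fun _ => S × A) n τ) := by
  have hmem (j : Finset.range (n + 1)) : (j : ℕ) ∈ Finset.Iic n :=
    Finset.mem_Iic.2 (Nat.lt_succ_iff.1 (Finset.mem_range.1 j.2))
  refine ⟨fun x => ∑ j ∈ (Finset.range (n + 1)).attach,
    score θ (x ⟨j, hmem j⟩).1 (x ⟨j, hmem j⟩).2, fun τ => ?_⟩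
  rw [← Finset.sum_attach]
  rfl

theorem integrable_smul_sum_score (μ : Measure (ℕ → S × A)) [IsFiniteMeasure μ] (θ : Param S A)
    (n : ℕ) (f : S × A → ℝ) :
    Integrable (fun τ : ℕ → S × A =>
      f (τ n) • ∑ j ∈ Finset.range (n + 1), score θ (τ j).1 (τ j).2) μ := by
  obtain ⟨G, hG⟩ := exists_sum_score_eq_comp_frestrictLe θ n
  simp_rw [hG]
  exact integrable_comp_frestrictLe μ n fun x => f (x ⟨n, Finset.mem_Iic.2 le_rfl⟩) • G x

variable [Nonempty A]

/-- The likelihood-ratio formula for the probability of being at `z` at time `n`. -/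
theorem hasGradientAt_integral_indicator (M : MDP S A) (ρ : PMF S) (θ : Param S A) (n : ℕ)
    (z : S × A) :
    HasGradientAt
      (fun θ' : Param S A => ∫ τ, Set.indicator {z} (1 : S × A → ℝ) (τ n)
        ∂(M.trajectoryLawFrom (softmaxPolicy θ') ρ))
      (∫ τ, Set.indicator {z} (1 : S × A → ℝ) (τ n) •
        ∑ j ∈ Finset.range (n + 1), score θ (τ j).1 (τ j).2
        ∂(M.trajectoryLawFrom (softmaxPolicy θ) ρ)) θ := by
  classical
  induction n generalizing z with
  | zero =>
    have h := (hasGradientAt_softmaxProb θ z.1 z.2).fun_const_mul_real (ρ z.1).toReal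
    convert h using 1
    · funext θ'
      unfold trajectoryLawFrom
      rw [integral_eval_zero]
      simp [Set.indicator_apply, stateActionLaw_apply]
    · unfold trajectoryLawFrom
      simp only [zero_add, Finset.range_one, Finset.sum_singleton]
      rw [integral_eval_zero M _ _
        fun x => Set.indicator {z} (1 : S × A → ℝ) x • score θ x.1 x.2]
      simp [Set.indicator_apply, ite_smul, stateActionLaw_apply, mul_smul]
  | succ n ih =>
    have hrec (θ' : Param S A) (z' : S × A) :
        ∫ τ, Set.indicator {z'} (1 : S × A → ℝ) (τ (n + 1))
          ∂(M.trajectoryLawFrom (softmaxPolicy θ') ρ) =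
        ∑ y, (M.P y.1 y.2 z'.1).toReal * (softmaxProb θ' z'.1 z'.2 *
          ∫ τ, Set.indicator {y} (1 : S × A → ℝ) (τ n)
            ∂(M.trajectoryLawFrom (softmaxPolicy θ') ρ)) := by
      simpa [mul_assoc] using
        integral_indicator_succ_smul M (softmaxPolicy θ') ρ n z' fun _ => (1 : ℝ)
    have h := HasGradientAt.fun_sum_real (t := Finset.univ) fun y _ =>
      ((hasGradientAt_softmaxProb θ z.1 z.2).fun_mul_real (ih y)).fun_const_mul_real
        (M.P y.1 y.2 z.1).toReal
    convert h using 1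
    · funext θ'
      exact hrec θ' z
    · set μ := M.trajectoryLawFrom (softmaxPolicy θ) ρ with hμ
      -- On the event that the pair at time `n + 1` is `z`, the newest score is the constant `score
      -- θ z.1 z.2`; the remaining scores depend only on the history up to `n`. These are the two
      -- terms of the product rule.
      have hsplit (τ : ℕ → S × A) : Set.indicator {z} (1 : S × A → ℝ) (τ (n + 1)) •
          ∑ j ∈ Finset.range (n + 1 + 1), score θ (τ j).1 (τ j).2 =
          Set.indicator {z} (1 : S × A → ℝ) (τ (n + 1)) •
            ∑ j ∈ Finset.range (n + 1), score θ (τ j).1 (τ j).2 +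
          Set.indicator {z} (1 : S × A → ℝ) (τ (n + 1)) • score θ z.1 z.2 := by
        rw [Finset.sum_range_succ, smul_add]
        by_cases hz : τ (n + 1) = z <;> simp [hz]
      obtain ⟨G, hG⟩ := exists_sum_score_eq_comp_frestrictLe θ n
      have hint : Integrable (fun τ => Set.indicator {z} (1 : S × A → ℝ) (τ (n + 1)) •
          G (Preorder.frestrictLe (π := fun _ => S × A) n τ)) μ :=
        integrable_comp_frestrictLe μ (n + 1) fun x =>
          Set.indicator {z} (1 : S × A → ℝ) (x ⟨n + 1, Finset.mem_Iic.2 le_rfl⟩) •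
            G (fun i => x ⟨i, Finset.mem_Iic.2 ((Finset.mem_Iic.1 i.2).trans n.le_succ)⟩)
      simp_rw [hsplit, hG]
      rw [integral_add hint (integrable_eval μ (n + 1) fun x =>
        Set.indicator {z} (1 : S × A → ℝ) x • score θ z.1 z.2), integral_smul_const, hrec,
        integral_indicator_succ_smul, Finset.sum_smul, ← Finset.sum_add_distrib]
      refine Finset.sum_congr rfl fun y _ => ?_
      simp only [toReal_softmaxPolicy, smul_add, smul_smul]
      congr 3
      ring

end MDP

/-! ### Series: termwise gradients and the dominating tail -/

/-- Term-by-term differentiation of a series, in terms of gradients. -/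
theorem hasGradientAt_tsum {ι F : Type*} [NormedAddCommGroup F] [InnerProductSpace ℝ F]
    [CompleteSpace F] {u : ι → ℝ} {f : ι → F → ℝ} {f' : ι → F → F} {x₀ : F} (hu : Summable u)
    (hf : ∀ i x, HasGradientAt (f i) (f' i x) x) (hf' : ∀ i x, ‖f' i x‖ ≤ u i)
    (hf0 : Summable fun i => f i x₀) (x : F) :
    HasGradientAt (fun y => ∑' i, f i y) (∑' i, f' i x) x := by
  rw [hasGradientAt_iff_hasFDerivAt]
  have h := hasFDerivAt_tsum hu (fun i x => (hf i x).hasFDerivAt)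
    (fun i x => by rw [LinearIsometryEquiv.norm_map]; exact hf' i x) hf0 x
  have hmap := (InnerProductSpace.toDual ℝ F).toContinuousLinearEquiv.map_tsum
    (f := fun i => f' i x) (L := .unconditional ι)
  exact hmap ▸ h

/-- Splitting `n + H + 1` into `H + 1` and `n` gives two standard series, and `H + 1 + γ / (1 - γ) =
H + 1 / (1 - γ)`. The case `H = 0` supplies the summable majorant for termwise differentiation. -/
theorem hasSum_shifted_succ_mul_geometric {γ : ℝ} (hγ0 : 0 < γ) (hγ1 : γ < 1) (c : ℝ) (H : ℕ) :
    HasSum (fun n : ℕ => γ ^ (n + H) * (2 * ((n + H : ℕ) + 1) * c))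
      (2 * c * γ ^ H / (1 - γ) * (H + 1 / (1 - γ))) := by
  have hne : 1 - γ ≠ 0 := by linarith
  have h1 := (hasSum_geometric_of_lt_one hγ0.le hγ1).mul_left (2 * c * γ ^ H * (H + 1))
  have h2 := (hasSum_coe_mul_geometric_of_norm_lt_one (r := γ)
    (by rwa [Real.norm_of_nonneg hγ0.le])).mul_left (2 * c * γ ^ H)
  convert! h1.add h2 using 1
  · funext n
    push_cast
    ring
  · field_simp
    ring

/-! ### Policy gradient of the regularized objective and truncation bias -/

namespace MDP

variable {S A : Type*} [Fintype S] [Fintype A]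

/-- The entropy-regularized reward `r(s, a) - λ log π_θ(a | s)`. -/
def regReward (M : MDP S A) (lam : ℝ) (θ : Param S A) (z : S × A) : ℝ :=
  M.r z.1 z.2 - lam * Real.log (softmaxProb θ z.1 z.2)

theorem truncatedPG_eq (M : MDP S A) (lam : ℝ) (θ : Param S A) (H : ℕ) (τ : ℕ → S × A) :
    M.truncatedPG lam θ H τ = ∑ h ∈ Finset.range H, M.γ ^ h • (M.regReward lam θ (τ h) •
      ∑ j ∈ Finset.range (h + 1), score θ (τ j).1 (τ j).2) := by
  simp only [truncatedPG, regReward, mul_smul]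

theorem regReward_nonneg [Nonempty A] (M : MDP S A) (hr : ∀ s a, 0 ≤ M.r s a) {lam : ℝ}
    (hlam : 0 ≤ lam) (θ : Param S A) (z : S × A) : 0 ≤ M.regReward lam θ z := by
  have h := Real.log_nonpos (softmaxProb_pos θ z.1 z.2).le (softmaxProb_le_one θ z.1 z.2)
  have h1 := hr z.1 z.2
  have h2 := mul_nonneg hlam (neg_nonneg.2 h)
  unfold regReward
  linarith

theorem hasGradientAt_regReward [Nonempty A] (M : MDP S A) (lam : ℝ) (θ : Param S A)
    (z : S × A) :
    HasGradientAt (fun θ' => M.regReward lam θ' z) (-lam • score θ z.1 z.2) θ := by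
  have h := ((hasGradientAt_log_softmaxProb θ z.1 z.2).fun_const_mul_real (-lam)).hasFDerivAt
  rw [hasGradientAt_iff_hasFDerivAt]
  convert! h.const_add (M.r z.1 z.2) using 1
  funext θ'
  simp [regReward, sub_eq_add_neg]

variable [MeasurableSpace S] [DiscreteMeasurableSpace S]
  [MeasurableSpace A] [DiscreteMeasurableSpace A]

/-- Exchange of expectation and discounted sum for a bounded function of the current pair. -/
theorem hasSum_integral_discounted (μ : Measure (ℕ → S × A)) [IsProbabilityMeasure μ] {γ : ℝ}
    (hγ0 : 0 < γ) (hγ1 : γ < 1) (g : S × A → ℝ) :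
    HasSum (fun n : ℕ => γ ^ n * ∫ τ, g (τ n) ∂μ) (∫ τ, ∑' n : ℕ, γ ^ n * g (τ n) ∂μ) := by
  have hint (n : ℕ) : Integrable (fun τ : ℕ → S × A => γ ^ n * g (τ n)) μ :=
    integrable_eval μ n fun z => γ ^ n * g z
  simp_rw [← integral_const_mul]
  refine hasSum_integral_of_summable_integral_norm hint ?_
  refine Summable.of_nonneg_of_le (fun n => integral_nonneg fun τ => norm_nonneg _) (fun n => ?_)
    ((summable_geometric_of_lt_one hγ0.le hγ1).mul_right (∑ z, ‖g z‖))
  have hle (τ : ℕ → S × A) : ‖γ ^ n * g (τ n)‖ ≤ γ ^ n * ∑ z, ‖g z‖ := by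
    rw [norm_mul, Real.norm_of_nonneg (pow_nonneg hγ0.le n)]
    exact mul_le_mul_of_nonneg_left (Finset.single_le_sum (f := fun z => ‖g z‖)
      (fun z _ => norm_nonneg _) (Finset.mem_univ _)) (pow_nonneg hγ0.le n)
  refine (integral_mono (hint n).norm (integrable_const _) hle).trans_eq ?_
  simp

/-- The value is built from `Q` at fixed starting pairs; mixing these starts according to
`stateActionLaw ρ π` recovers the single law used by the entropy term and the estimator. -/
theorem hasSum_value (M : MDP S A) (hγ0 : 0 < M.γ) (hγ1 : M.γ < 1) (π : S → PMF A) (ρ : PMF S) :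
    HasSum (fun n : ℕ => M.γ ^ n * ∫ τ, M.r (τ n).1 (τ n).2 ∂(M.trajectoryLawFrom π ρ))
      (M.value π ρ) := by
  have hQ (z : S × A) : HasSum (fun n : ℕ => M.γ ^ n *
      ∫ τ, M.r (τ n).1 (τ n).2 ∂(M.trajectoryLaw π (PMF.pure z))) (M.Q π z.1 z.2) :=
    hasSum_integral_discounted _ hγ0 hγ1 fun z => M.r z.1 z.2
  have h := hasSum_sum (s := Finset.univ)
    fun z _ => (hQ z).mul_left (stateActionLaw ρ π z).toReal
  convert! h using 1
  · funext n
    unfold trajectoryLawFrom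
    rw [integral_eval_eq_sum_pure M π _ n fun z => M.r z.1 z.2, Finset.mul_sum]
    refine Finset.sum_congr rfl fun z _ => ?_
    simp only [smul_eq_mul]
    ring
  · exact (sum_stateActionLaw_smul ρ π fun z => M.Q π z.1 z.2).symm

theorem integrable_truncatedPG (M : MDP S A) (lam : ℝ) (θ : Param S A) (H : ℕ)
    (μ : Measure (ℕ → S × A)) [IsFiniteMeasure μ] : Integrable (M.truncatedPG lam θ H) μ := by
  simp_rw [funext (M.truncatedPG_eq lam θ H)]
  exact integrable_finsetSum _ fun h _ =>
    (integrable_smul_sum_score μ θ h (M.regReward lam θ)).fun_smul _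

variable [Nonempty A]

theorem hasSum_regObjective (M : MDP S A) (hγ0 : 0 < M.γ) (hγ1 : M.γ < 1) (lam : ℝ) (ρ : PMF S)
    (θ : Param S A) :
    HasSum (fun n : ℕ => M.γ ^ n *
        ∫ τ, M.regReward lam θ (τ n) ∂(M.trajectoryLawFrom (softmaxPolicy θ) ρ))
      (M.regObjective lam ρ θ) := by
  have h1 := M.hasSum_value hγ0 hγ1 (softmaxPolicy θ) ρ
  have h2 := (hasSum_integral_discounted (M.trajectoryLawFrom (softmaxPolicy θ) ρ) hγ0 hγ1
    fun z => -Real.log (softmaxProb θ z.1 z.2)).mul_left lam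
  convert h1.add h2 using 1
  · funext n
    have hadd := integral_add (μ := M.trajectoryLawFrom (softmaxPolicy θ) ρ)
      (integrable_eval _ n fun z => M.r z.1 z.2)
      (integrable_eval _ n fun z => lam * -Real.log (softmaxProb θ z.1 z.2))
    rw [integral_const_mul] at hadd
    rw [mul_left_comm, ← mul_add, ← hadd]
    simp [regReward, sub_eq_add_neg]
  · simp [regObjective, regValue, discountedEntropy]

theorem integral_regReward_le (M : MDP S A) {rbar : ℝ} (hr : ∀ s a, M.r s a ≤ rbar) {lam : ℝ}
    (hlam : 0 ≤ lam) (ρ : PMF S) (θ : Param S A) (n : ℕ) :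
    ∫ τ, M.regReward lam θ (τ n) ∂(M.trajectoryLawFrom (softmaxPolicy θ) ρ) ≤
      rbar + lam * Real.log (Fintype.card A) := by
  refine integral_eval_le_of_policy_mean_le M _ ρ n fun s => ?_
  simp only [toReal_softmaxPolicy]
  calc ∑ a, softmaxProb θ s a * M.regReward lam θ (s, a)
      ≤ ∑ a, (softmaxProb θ s a * rbar +
          lam * (softmaxProb θ s a * -Real.log (softmaxProb θ s a))) := by
        refine Finset.sum_le_sum fun a _ => ?_
        have h := mul_le_mul_of_nonneg_left (hr s a) (softmaxProb_pos θ s a).le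
        simp only [regReward]
        linarith
    _ ≤ rbar + lam * Real.log (Fintype.card A) := by
        rw [Finset.sum_add_distrib, ← Finset.sum_mul, sum_softmaxProb, one_mul, ← Finset.mul_sum]
        gcongr
        exact sum_softmaxProb_mul_neg_log_le θ s

/-- The contribution `𝔼[(r_n - λ log π_n) ∑_{j ≤ n} ∇ log π(a_j | s_j)]` of time `n` to the policy
gradient, without discounting. -/
def stepGradient (M : MDP S A) (lam : ℝ) (ρ : PMF S) (n : ℕ) (θ : Param S A) : Param S A :=
  ∫ τ, M.regReward lam θ (τ n) • ∑ j ∈ Finset.range (n + 1), score θ (τ j).1 (τ j).2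
    ∂(M.trajectoryLawFrom (softmaxPolicy θ) ρ)

theorem hasGradientAt_integral_regReward (M : MDP S A) (lam : ℝ) (ρ : PMF S) (n : ℕ)
    (θ : Param S A) :
    HasGradientAt (fun θ' : Param S A =>
        ∫ τ, M.regReward lam θ' (τ n) ∂(M.trajectoryLawFrom (softmaxPolicy θ') ρ))
      (M.stepGradient lam ρ n θ) θ := by
  have h := HasGradientAt.fun_sum_real (t := Finset.univ) fun z _ =>
    (hasGradientAt_regReward M lam θ z).fun_mul_real (hasGradientAt_integral_indicator M ρ θ n z)
  convert h using 1
  · funext θ'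
    simpa using (sum_integral_indicator_smul (M.trajectoryLawFrom (softmaxPolicy θ') ρ) n
      (M.regReward lam θ') fun _ => (1 : ℝ)).symm
  · obtain ⟨G, hG⟩ := exists_sum_score_eq_comp_frestrictLe θ n
    -- The contribution of differentiating `-λ log π_θ` inside the reward: an expected score at time
    -- `n`, hence zero.
    have hscore : ∑ z, (∫ τ, Set.indicator {z} (1 : S × A → ℝ) (τ n)
        ∂(M.trajectoryLawFrom (softmaxPolicy θ) ρ)) • -lam • score θ z.1 z.2 = 0 := by
      simp_rw [← integral_smul_const]
      rw [← integral_finsetSum _ fun z _ => integrable_eval _ n fun x =>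
        Set.indicator {z} (1 : S × A → ℝ) x • -lam • score θ z.1 z.2]
      simp_rw [indicator_singleton_sum_smul fun z : S × A => -lam • score θ z.1 z.2]
      refine integral_eval_eq_zero_of_policy_mean_eq_zero M _ ρ n
        (g := fun z => -lam • score θ z.1 z.2) fun s => ?_
      simp only [toReal_softmaxPolicy, smul_comm _ (-lam)]
      rw [← Finset.smul_sum, sum_softmaxProb_smul_score, smul_zero]
    simp_rw [Finset.sum_add_distrib, hscore, add_zero, stepGradient, hG]
    exact (sum_integral_indicator_smul _ n (M.regReward lam θ) G).symm

theorem norm_stepGradient_le (M : MDP S A) {rbar : ℝ} (hr : ∀ s a, 0 ≤ M.r s a ∧ M.r s a ≤ rbar)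
    {lam : ℝ} (hlam : 0 ≤ lam) (ρ : PMF S) (n : ℕ) (θ : Param S A) :
    ‖M.stepGradient lam ρ n θ‖ ≤ 2 * (n + 1) * (rbar + lam * Real.log (Fintype.card A)) := by
  have hle (τ : ℕ → S × A) :
      ‖M.regReward lam θ (τ n) • ∑ j ∈ Finset.range (n + 1), score θ (τ j).1 (τ j).2‖ ≤
        2 * (n + 1) * M.regReward lam θ (τ n) := by
    have h0 := M.regReward_nonneg (fun s a => (hr s a).1) hlam θ (τ n)
    have h1 : ‖∑ j ∈ Finset.range (n + 1), score θ (τ j).1 (τ j).2‖ ≤ 2 * (n + 1) := by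
      refine (norm_sum_le_of_le _ fun j _ => norm_score_le θ _ _).trans_eq ?_
      simp [mul_comm]
    -- Nonnegativity removes the absolute value, so the bound on the expected regularized reward
    -- applies after integrating.
    rw [norm_smul, Real.norm_of_nonneg h0, mul_comm]
    exact mul_le_mul_of_nonneg_right h1 h0
  refine (norm_integral_le_of_norm_le ((integrable_eval _ n (M.regReward lam θ)).const_mul _)
    (.of_forall hle)).trans ?_
  rw [integral_const_mul]
  exact mul_le_mul_of_nonneg_left (M.integral_regReward_le (fun s a => (hr s a).2) hlam ρ θ n)
    (by positivity)

theorem integral_truncatedPG (M : MDP S A) (lam : ℝ) (ρ : PMF S) (θ : Param S A) (H : ℕ) :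
    ∫ τ, M.truncatedPG lam θ H τ ∂(M.trajectoryLawFrom (softmaxPolicy θ) ρ) =
      ∑ h ∈ Finset.range H, M.γ ^ h • M.stepGradient lam ρ h θ := by
  simp_rw [truncatedPG_eq, stepGradient]
  rw [integral_finsetSum _ fun h _ =>
    (integrable_smul_sum_score _ θ h (M.regReward lam θ)).fun_smul _]
  simp_rw [integral_smul]

theorem norm_discounted_stepGradient_le (M : MDP S A) (hγ0 : 0 < M.γ) {rbar : ℝ}
    (hr : ∀ s a, 0 ≤ M.r s a ∧ M.r s a ≤ rbar) {lam : ℝ} (hlam : 0 ≤ lam) (ρ : PMF S) (n : ℕ)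
    (θ : Param S A) :
    ‖M.γ ^ n • M.stepGradient lam ρ n θ‖ ≤
      M.γ ^ n * (2 * (n + 1) * (rbar + lam * Real.log (Fintype.card A))) := by
  rw [norm_smul, Real.norm_of_nonneg (pow_nonneg hγ0.le n)]
  exact mul_le_mul_of_nonneg_left (M.norm_stepGradient_le hr hlam ρ n θ) (pow_nonneg hγ0.le n)

/-- The policy gradient theorem for the entropy-regularized softmax objective. -/
theorem hasGradientAt_regObjective (M : MDP S A) (hγ0 : 0 < M.γ) (hγ1 : M.γ < 1) {rbar : ℝ}
    (hr : ∀ s a, 0 ≤ M.r s a ∧ M.r s a ≤ rbar) {lam : ℝ} (hlam : 0 ≤ lam) (ρ : PMF S)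
    (θ : Param S A) :
    HasGradientAt (M.regObjective lam ρ) (∑' n : ℕ, M.γ ^ n • M.stepGradient lam ρ n θ) θ := by
  have hsum (θ' : Param S A) := M.hasSum_regObjective hγ0 hγ1 lam ρ θ'
  rw [funext fun θ' => (hsum θ').tsum_eq.symm]
  refine hasGradientAt_tsum (hasSum_shifted_succ_mul_geometric hγ0 hγ1
    (rbar + lam * Real.log (Fintype.card A)) 0).summable (fun n θ' =>
      (M.hasGradientAt_integral_regReward lam ρ n θ').fun_const_mul_real _) (fun n θ' => ?_)
    (hsum θ).summable θ
  exact M.norm_discounted_stepGradient_le hγ0 hr hlam ρ n θ'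

theorem norm_truncationBias_le (M : MDP S A) (hγ0 : 0 < M.γ) (hγ1 : M.γ < 1) {rbar : ℝ}
    (hr : ∀ s a, 0 ≤ M.r s a ∧ M.r s a ≤ rbar) {lam : ℝ} (hlam : 0 ≤ lam) (ρ : PMF S)
    (θ : Param S A) (H : ℕ) :
    ‖M.truncationBias lam ρ θ H‖ ≤
      2 * (rbar + lam * Real.log (Fintype.card A)) * M.γ ^ H / (1 - M.γ) *
        (H + 1 / (1 - M.γ)) := by
  have hle (n : ℕ) := M.norm_discounted_stepGradient_le hγ0 hr hlam ρ n θ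
  have hs : Summable fun n : ℕ => M.γ ^ n • M.stepGradient lam ρ n θ :=
    Summable.of_norm_bounded (hasSum_shifted_succ_mul_geometric hγ0 hγ1
      (rbar + lam * Real.log (Fintype.card A)) 0).summable hle
  -- The first `H` terms of the gradient series are the mean of the estimator and cancel, leaving
  -- minus the tail.
  rw [truncationBias, integral_truncatedPG,
    (M.hasGradientAt_regObjective hγ0 hγ1 hr hlam ρ θ).gradient, ← hs.sum_add_tsum_nat_add H,
    sub_add_cancel_left, norm_neg]
  exact tsum_of_norm_bounded (hasSum_shifted_succ_mul_geometric hγ0 hγ1 _ H)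
    fun n => hle (n + H)

end MDP

/-- The linear factor is absorbed by the gap between `γ` and `q`: both `n * γ ^ n` and `γ ^ n` are
`o(q ^ n)`. -/
theorem isBigO_geometric_of_le_linear_mul_pow {f : ℕ → ℝ} {γ q K c : ℝ} (hγ0 : 0 < γ)
    (hγq : γ < q) (hf0 : ∀ n, 0 ≤ f n) (hf : ∀ n, f n ≤ K * γ ^ n * (n + c)) :
    f =O[Filter.atTop] fun n : ℕ => q ^ n := by
  have hγ : ‖γ‖ < q := by rwa [Real.norm_of_nonneg hγ0.le]
  have h1 := (isLittleO_pow_const_mul_const_pow_const_pow_of_norm_lt 1 hγ).isBigO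
  have h0 := (isLittleO_pow_const_mul_const_pow_const_pow_of_norm_lt 0 hγ).isBigO
  refine Asymptotics.IsBigO.trans (.of_norm_le fun n => ?_)
    ((h1.const_mul_left K).add (h0.const_mul_left (K * c)))
  rw [Real.norm_of_nonneg (hf0 n)]
  refine (hf n).trans_eq ?_
  simp only [pow_one, pow_zero]
  ring

end

theorem mainTheorem7 {S A : Type*} [Fintype S] [Fintype A] [Nonempty A]
    [MeasurableSpace S] [DiscreteMeasurableSpace S]
    [MeasurableSpace A] [DiscreteMeasurableSpace A]
    (M : MDP S A) (hγ0 : 0 < M.γ) (hγ1 : M.γ < 1)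
    (rbar : ℝ) (hr : ∀ s a, 0 ≤ M.r s a ∧ M.r s a ≤ rbar)
    (lam : ℝ) (hlam : 0 ≤ lam) (ρ : PMF S) (θ : Param S A) :
    DifferentiableAt ℝ (M.regObjective lam ρ) θ ∧
    (∀ H : ℕ,
      Integrable (M.truncatedPG lam θ H) (M.trajectoryLawFrom (softmaxPolicy θ) ρ) ∧
      ‖M.truncationBias lam ρ θ H‖ ≤
        2 * (rbar + lam * Real.log (Fintype.card A)) * M.γ ^ H / (1 - M.γ) *
          (H + 1 / (1 - M.γ))) ∧
    ∀ q : ℝ, M.γ < q → q < 1 →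
      (fun H : ℕ => ‖M.truncationBias lam ρ θ H‖) =O[Filter.atTop] (fun H : ℕ => q ^ H) := by
  have hbias := M.norm_truncationBias_le hγ0 hγ1 hr hlam ρ θ
  refine ⟨(M.hasGradientAt_regObjective hγ0 hγ1 hr hlam ρ θ).differentiableAt,
    fun H => ⟨M.integrable_truncatedPG lam θ H _, hbias H⟩, fun q hq _ => ?_⟩
  refine isBigO_geometric_of_le_linear_mul_pow hγ0 hq (fun _ => norm_nonneg _)
    (K := 2 * (rbar + lam * Real.log (Fintype.card A)) / (1 - M.γ)) (c := 1 / (1 - M.γ))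
    fun H => (hbias H).trans_eq ?_
  ring
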